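/- **Setting.** Let $V$ be a real Banach space, $\vec e\in V$ a fixed nonzero vector (for instance a unit vector), and $G$ a group of (invertible) linear isometries of $V$ (for instance $V=\mathbb R^2$, $\vec e=(1,0)$, $G=SO(2)$). A *unit curve* is a continuous map $c:[0,1]\to V$ with $c(0)=0$ and $c(1)=\vec e$; $C_1$ is the set of unit curves. **Rules.** A *rule* over a set $X$ is a pair $(a,t)$ of a real number $a$ and a nonempty list $t$ of elements of the disjoint union $G+X$. Put $\mathrm{span}([\,])=0$, $\mathrm{dir}([\,])=1$; for $\rho\in G$, $\mathrm{span}(\rho::u)=\rho\,\mathrm{span}(u)$ and $\mathrm{dir}(\rho::u)=\rho\,\mathrm{dir}(u)$; for $x\in X$, $\mathrm{span}(x::u)=\vec e+\mathrm{span}(u)$ and $\mathrm{dir}(x::u)=\mathrm{dir}(u)$. The rule is *well-formed* if $a>1$, $\mathrm{span}(t)=a\vec e$ and $\mathrm{dir}(t)=1$. Let $\mathcal L$ be the endofunctor of sets that sends $X$ to the set of well-formed rules over $X$ (replacing nonterminals on maps); an element of $\mathcal L 1$ is a *rule shape*, and the shape of $r\in\mathcal LX$ is its image in $\mathcal L1$.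 **Rule interpretation.** For $t$ a nonempty list over $G+C_1$ of length $\ell$ define $\mathrm{step}(t):[0,\ell]\to V$ by $\mathrm{step}(\rho::u)(x)=0$ if $x\le 1$ and $\rho\,\mathrm{step}(u)(x-1)$ if $x>1$; $\mathrm{step}(c::u)(x)=c(x)$ if $x\le 1$ and $\vec e+\mathrm{step}(u)(x-1)$ if $x>1$. Then $\mathrm{draw}(a,t)(z)=a^{-1}\,\mathrm{step}(t)(\ell z)$ defines an $\mathcal L$-algebra $\mathrm{draw}:\mathcal L C_1\to C_1$. **The comonad.** Let $\mathcal L^\infty$ be the cofree comonad over $\mathcal L$: $\mathcal L^\infty X$ is the final coalgebra of $X\times\mathcal L(-)$, with structure $\langle\varepsilon,\theta\rangle$, i.e. the set of possibly infinite $X$-labelled trees of nested well-formed rules; the comultiplication labels each node with the subtree below it. Let $\chi=\mathcal L\varepsilon\circ\theta:\mathcal L^\infty\Rightarrow\mathcal L$. The *shape-finitary subcomonad* $\mathbb D=(D,\varepsilon,\nu)$ is given by $DX=\{t\in\mathcal L^\infty X : \text{only finitely many rule shapes occur in } t \text{, over all finite depths}\}$. Let $k:DC_1\to C_1$ be the restriction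 of $\mathrm{draw}\circ\chi_{C_1}$ to $DC_1$. **Homomorphisms.** For a functor $F$, a *ca-homomorphism* from an $F$-coalgebra $f:X\to FX$ to an $F$-algebra $g:FY\to Y$ is a map $h:X\to Y$ with $h=g\circ Fh\circ f$. A coalgebra of the comonad $\mathbb D$ is a map $f:X\to DX$ with $\varepsilon_X\circ f=\mathrm{id}$ and $\nu_X\circ f=Df\circ f$. **Theorem.** The $D$-algebra $(C_1,k)$ is corecursive, in the sense that from every coalgebra of the comonad $\mathbb D$ there is exactly one ca-homomorphism to $(C_1,k)$. In particular, for every finite well-formed L-system, i.e. every finite set $X$ with a map $f:X\to\mathcal LX$, the coalgebra $f^\sharp:X\to\mathcal L^\infty X$ of $\mathcal L^\infty$ that it generates (the unique map with $\varepsilon_X\circ f^\sharp=\mathrm{id}$ and $\theta_X\circ f^\sharp=\mathcal L f^\sharp\circ f$) takes its values in $DX$ and is a $\mathbb D$-coalgebra, and there is exactly one ca-homomorphism $h:X\to C_1$ from $(X,f^\sharp)$ to $(C_1,k)$; moreover, the ca-homomorphisms from $(X,f^\sharp)$ to $(C_1,k)$ are the same as the $\mathcal L$-ca-homomorphisms from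 $(X,f)$ to $(C_1,\mathrm{draw})$. -/

import Mathlib

open CategoryTheory

universe u

namespace FractalLSystem

/-! ## Coalgebra-algebra homomorphisms and corecursive algebras -/

/-- `h` is an `F`-ca-homomorphism from the `F`-coalgebra `(X, f)` to the `F`-algebra `(Y, g)`,
i.e. `h = g ∘ F h ∘ f`. -/
def IsCAHom {C : Type*} [Category C] (F : C ⥤ C) {X Y : C}
    (f : X ⟶ F.obj X) (g : F.obj Y ⟶ Y) (h : X ⟶ Y) : Prop :=
  h = f ≫ F.map h ≫ g

/-- An algebra `B` of (the underlying functor of) a comonad `D` is corecursive: from every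
coalgebra of the comonad `D` there is exactly one ca-homomorphism to `B`. -/
def IsCorecursive {C : Type*} [Category C] (D : Comonad C)
    (B : Endofunctor.Algebra D.toFunctor) : Prop :=
  ∀ A : D.Coalgebra, ∃! h : A.A ⟶ B.a, IsCAHom D.toFunctor A.a B.str h

section

variable {V : Type u} [NormedAddCommGroup V] [NormedSpace ℝ V]

/-! ## Fractal rules, well-formedness, and the functor of well-formed rules -/

/-- Fractal rules `ℝ × (G + X)⁺` over the nonterminals `X` : a shrink factor and a nonempty list
of turns (elements of `G`) and nonterminals. -/
abbrev FrRule (G : Subgroup (V ≃ₗᵢ[ℝ] V)) (X : Type u) : Type u :=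
  ℝ × {l : List (G ⊕ X) // l ≠ []}

/-- Overall change of position when tracing the list in turtle fashion. -/
def span {G : Subgroup (V ≃ₗᵢ[ℝ] V)} (e : V) {X : Type u} : List (G ⊕ X) → V
  | [] => 0
  | Sum.inl ρ :: t => (ρ : V ≃ₗᵢ[ℝ] V) (span e t)
  | Sum.inr _ :: t => e + span e t

/-- Overall change of orientation. -/
def dir {G : Subgroup (V ≃ₗᵢ[ℝ] V)} {X : Type u} : List (G ⊕ X) → G
  | [] => 1
  | Sum.inl ρ :: t => ρ * dir t
  | Sum.inr _ :: t => dir t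

/-- Well-formed rules. -/
def Wfr {G : Subgroup (V ≃ₗᵢ[ℝ] V)} (e : V) {X : Type u} (r : FrRule G X) : Prop :=
  1 < r.1 ∧ span e r.2.1 = r.1 • e ∧ dir r.2.1 = 1

/-- The action of the fractal Lindenmayer functor on functions. -/
def FrRule.map {G : Subgroup (V ≃ₗᵢ[ℝ] V)} {X Y : Type u} (f : X → Y) (r : FrRule G X) :
    FrRule G Y :=
  (r.1, ⟨r.2.1.map (Sum.map id f), by simpa using r.2.2⟩)

variable {G : Subgroup (V ≃ₗᵢ[ℝ] V)} {e : V} {X Y Z : Type u}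

theorem span_map (f : X → Y) (l : List (G ⊕ X)) :
    span e (l.map (Sum.map id f)) = span e l := by
  induction l with
  | nil => rfl
  | cons a t ih => cases a <;> simp [span, ih]

theorem dir_map (f : X → Y) (l : List (G ⊕ X)) :
    dir (l.map (Sum.map id f)) = dir l := by
  induction l with
  | nil => rfl
  | cons a t ih => cases a <;> simp [dir, ih]

theorem Wfr.map (f : X → Y) {r : FrRule G X} (h : Wfr e r) : Wfr e (r.map f) :=
  ⟨h.1, (span_map f _).trans h.2.1, (dir_map f _).trans h.2.2⟩

variable (G e) in
/-- The set of well-formed rules over the nonterminals `X`. -/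
abbrev WfRule (X : Type u) : Type u := {r : FrRule G X // Wfr e r}

namespace WfRule

/-- The list of symbols of a rule. -/
abbrev body (r : WfRule G e X) : List (G ⊕ X) := r.1.2.1

/-- Well-formed rules form a subfunctor of the fractal Lindenmayer functor. -/
def map (f : X → Y) (r : WfRule G e X) : WfRule G e Y := ⟨r.1.map f, r.2.map f⟩

theorem ext' {r s : WfRule G e X} (h₁ : r.1.1 = s.1.1) (h₂ : r.body = s.body) : r = s :=
  Subtype.ext (Prod.ext h₁ (Subtype.ext h₂))

theorem map_id (r : WfRule G e X) : r.map id = r :=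
  ext' rfl (by simp [body, map, FrRule.map])

theorem map_map (f : X → Y) (g : Y → Z) (r : WfRule G e X) :
    (r.map f).map g = r.map (g ∘ f) :=
  ext' rfl (by simp [body, map, FrRule.map])

/-- The set of nonterminals that occur in a rule. -/
def nonterminals (r : WfRule G e X) : Set X := {x | Sum.inr x ∈ r.body}

/-- The shape of a rule: its image under the unique map of the nonterminals to a point. -/
def shape (r : WfRule G e X) : WfRule G e PUnit.{u + 1} := r.map fun _ => PUnit.unit

theorem shape_map (f : X → Y) (r : WfRule G e X) : (r.map f).shape = r.shape :=
  map_map _ _ _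

theorem nonterminals_map (f : X → Y) (r : WfRule G e X) :
    (r.map f).nonterminals = f '' r.nonterminals := by
  ext y
  simp [nonterminals, map, FrRule.map, body]

theorem map_injective {f : X → Y} (hf : Function.Injective f) :
    Function.Injective (map f : WfRule G e X → WfRule G e Y) := by
  intro r s h
  have h₁ : r.1.1 = s.1.1 := congrArg (fun t : WfRule G e Y => t.1.1) h
  have h₂ := congrArg body h
  exact ext' h₁ (List.map_injective_iff.2 (Sum.map_injective.2 ⟨fun _ _ h => h, hf⟩) h₂)

end WfRule

/-- Codomain restriction of a list of symbols to nonterminals with a property. -/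
def restrictList {p : X → Prop} :
    (l : List (G ⊕ X)) → (∀ x, Sum.inr x ∈ l → p x) → List (G ⊕ {x // p x})
  | [], _ => []
  | Sum.inl ρ :: t, h => Sum.inl ρ :: restrictList t fun x hx => h x (List.mem_cons_of_mem _ hx)
  | Sum.inr x :: t, h =>
    Sum.inr ⟨x, h x List.mem_cons_self⟩ ::
      restrictList t fun x hx => h x (List.mem_cons_of_mem _ hx)

theorem map_restrictList {p : X → Prop} (l : List (G ⊕ X)) (h : ∀ x, Sum.inr x ∈ l → p x) :
    (restrictList l h).map (Sum.map id Subtype.val) = l := by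
  induction l with
  | nil => rfl
  | cons a t ih => cases a <;> simp [restrictList, ih]

/-- A rule all whose nonterminals have the property `p`, as a rule over the subset `p`. -/
def WfRule.restrict {p : X → Prop} (r : WfRule G e X) (h : ∀ x ∈ r.nonterminals, p x) :
    WfRule G e {x // p x} :=
  ⟨(r.1.1, ⟨restrictList r.body h, fun h0 => r.1.2.2
      ((map_restrictList r.body h).symm.trans (congrArg (List.map (Sum.map id Subtype.val)) h0))⟩),
    r.2.1,
    ((span_map Subtype.val _).symm.trans (congrArg (span e) (map_restrictList r.body h))).trans
      r.2.2.1,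
    ((dir_map Subtype.val _).symm.trans (congrArg dir (map_restrictList r.body h))).trans
      r.2.2.2⟩

theorem WfRule.map_restrict {p : X → Prop} (r : WfRule G e X)
    (h : ∀ x ∈ r.nonterminals, p x) : (r.restrict h).map Subtype.val = r :=
  WfRule.ext' rfl (map_restrictList _ _)

variable (G e) in
/-- The endofunctor of well-formed rules on the category of sets. -/
def Lwfr : Type u ⥤ Type u where
  obj X := WfRule G e X
  map f := ↾(WfRule.map f)
  map_id X := by ext r : 3; exact WfRule.map_id r
  map_comp f g := by ext r : 3; exact (WfRule.map_map f g r).symm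

/-! ## The cofree comonad: final coalgebras of `X × Lwfr -` -/

variable (G e) in
/-- The functor `Y ↦ X × Lwfr Y`. -/
def Node (X Y : Type u) : Type u := X × WfRule G e Y

/-- Positions of the nonterminals in a list. -/
def Pos : List (G ⊕ PUnit.{u + 1}) → Type u
  | [] => PEmpty
  | Sum.inl _ :: t => Pos t
  | Sum.inr _ :: t => Option (Pos t)

/-- Filling the positions of nonterminals of a shape. -/
def fill : (l : List (G ⊕ PUnit.{u + 1})) → (Pos l → Y) → List (G ⊕ Y)
  | [], _ => []
  | Sum.inl ρ :: t, f => Sum.inl ρ :: fill t f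
  | Sum.inr _ :: t, f => Sum.inr (f none) :: fill t fun i => f (some i)

/-- Reading the positions of nonterminals of a list. -/
def content : (l : List (G ⊕ Y)) → Pos (l.map (Sum.map id fun _ => PUnit.unit)) → Y
  | [], i => i.elim
  | Sum.inl _ :: t, i => content t i
  | Sum.inr y :: _, none => y
  | Sum.inr _ :: t, some i => content t i

theorem fill_content (l : List (G ⊕ Y)) : fill _ (content l) = l := by
  induction l with
  | nil => rfl
  | cons a t ih =>
    cases a with
    | inl ρ => exact congrArg (List.cons (Sum.inl ρ)) ih
    | inr y => exact congrArg (List.cons (Sum.inr y)) ih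

theorem map_fill (g : Y → Z) (l : List (G ⊕ PUnit.{u + 1})) (f : Pos l → Y) :
    (fill l f).map (Sum.map id g) = fill l (g ∘ f) := by
  induction l with
  | nil => rfl
  | cons a t ih =>
    cases a with
    | inl ρ => exact congrArg (List.cons (Sum.inl ρ)) (ih f)
    | inr y => exact congrArg (List.cons (Sum.inr (g (f none)))) (ih fun i => f (some i))

theorem shape_fill (l : List (G ⊕ PUnit.{u + 1})) (f : Pos l → Y) :
    (fill l f).map (Sum.map id fun _ => PUnit.unit) = l := by
  induction l with
  | nil => rfl
  | cons a t ih =>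
    cases a with
    | inl ρ => exact congrArg (List.cons (Sum.inl ρ)) (ih f)
    | inr y => exact congrArg (List.cons (Sum.inr y)) (ih fun i => f (some i))

/-- Filling the positions of nonterminals of a rule shape. -/
def WfRule.fill (s : WfRule G e PUnit.{u + 1}) (f : Pos s.body → Y) : WfRule G e Y :=
  ⟨(s.1.1, ⟨FractalLSystem.fill s.body f, fun h0 => s.1.2.2 (by
      rw [← shape_fill s.1.2.1 f, h0]; rfl)⟩),
    s.2.1, by
      have := span_map (e := e) (fun _ => PUnit.unit.{u + 1}) (FractalLSystem.fill s.body f)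
      rw [shape_fill] at this
      exact this.symm.trans s.2.2.1, by
      have := dir_map (fun _ => PUnit.unit.{u + 1}) (FractalLSystem.fill s.body f)
      rw [shape_fill] at this
      exact this.symm.trans s.2.2.2⟩

/-- The functor `Y ↦ X × Lwfr Y` is polynomial; this makes Mathlib's final coalgebra
available. -/
instance instQPFNode (X : Type u) : QPF (Node G e X) where
  map f a := (a.1, a.2.map f)
  P := ⟨X × WfRule G e PUnit.{u + 1}, fun a => Pos a.2.body⟩
  abs p := (p.1.1, p.1.2.fill p.2)
  repr n := ⟨(n.1, n.2.shape), content n.2.body⟩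
  abs_repr _ := Prod.ext rfl (WfRule.ext' rfl (fill_content _))
  abs_map f _ := Prod.ext rfl (WfRule.ext' rfl (map_fill f _ _).symm)

variable (G e) in
/-- The cofree comonad over `Lwfr` on objects: the final coalgebra of `X × Lwfr -`, that is,
the `X`-labelled non-well-founded trees of nested well-formed rules. -/
def Tree (X : Type u) : Type u := QPF.Cofix (Node G e X)

namespace Tree

/-- The label of the root. -/
def label (t : Tree G e X) : X := (QPF.Cofix.dest t).1

/-- The rule at the root, over the immediate subtrees. -/
def theta (t : Tree G e X) : WfRule G e (Tree G e X) := (QPF.Cofix.dest t).2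

/-- The anamorphism of the coalgebra `⟨l, d⟩ : A → X × Lwfr A`. -/
def ana {A : Type u} (l : A → X) (d : A → WfRule G e A) : A → Tree G e X :=
  QPF.Cofix.corec (F := Node G e X) fun a => (l a, d a)

theorem label_ana {A : Type u} (l : A → X) (d : A → WfRule G e A) (a : A) :
    (ana l d a).label = l a :=
  congrArg Prod.fst (QPF.Cofix.dest_corec (F := Node G e X) (fun a => (l a, d a)) a)

theorem theta_ana {A : Type u} (l : A → X) (d : A → WfRule G e A) (a : A) :
    (ana l d a).theta = (d a).map (ana l d) :=
  congrArg Prod.snd (QPF.Cofix.dest_corec (F := Node G e X) (fun a => (l a, d a)) a)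

/-- Finality: coalgebra morphisms into the trees are unique. -/
theorem hom_unique {A : Type u} (l : A → X) (d : A → WfRule G e A) {φ ψ : A → Tree G e X}
    (hφ : ∀ a, (φ a).label = l a) (hφ' : ∀ a, (φ a).theta = (d a).map φ)
    (hψ : ∀ a, (ψ a).label = l a) (hψ' : ∀ a, (ψ a).theta = (d a).map ψ) (a : A) :
    φ a = ψ a := by
  let r : Tree G e X → Tree G e X → Prop := fun x y => ∃ a, x = φ a ∧ y = ψ a
  refine QPF.Cofix.bisim_rel (F := Node G e X) r ?_ _ _ ⟨a, rfl, rfl⟩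
  rintro _ _ ⟨a, rfl, rfl⟩
  refine Prod.ext ((hφ a).trans (hψ a).symm) ?_
  change (φ a).theta.map (Quot.mk r) = (ψ a).theta.map (Quot.mk r)
  rw [hφ', hψ', WfRule.map_map, WfRule.map_map]
  congr 1
  funext b
  exact Quot.sound ⟨b, rfl, rfl⟩

/-- Relabelling. -/
def map (f : X → Y) : Tree G e X → Tree G e Y := ana (f ∘ label) theta

/-- The comultiplication: every node is labelled with the subtree below it. -/
def dup : Tree G e X → Tree G e (Tree G e X) := ana id theta

/-- The projection of the cofree comonad to `Lwfr`: the root rule, over the labels of the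
immediate subtrees. -/
def chi (t : Tree G e X) : WfRule G e X := t.theta.map label

theorem label_map (f : X → Y) (t : Tree G e X) : (map f t).label = f t.label :=
  label_ana _ _ t

theorem theta_map (f : X → Y) (t : Tree G e X) : (map f t).theta = t.theta.map (map f) :=
  theta_ana _ _ t

theorem label_dup (t : Tree G e X) : (dup t).label = t :=
  label_ana _ _ t

theorem theta_dup (t : Tree G e X) : (dup t).theta = t.theta.map dup :=
  theta_ana _ _ t

theorem map_id' (t : Tree G e X) : map id t = t :=
  hom_unique label theta (label_map id) (theta_map id) (fun _ => rfl)
    (fun _ => (WfRule.map_id _).symm) t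

theorem map_comp' (f : X → Y) (g : Y → Z) (t : Tree G e X) :
    map (g ∘ f) t = map g (map f t) :=
  hom_unique (φ := map (g ∘ f)) (ψ := fun t => map g (map f t)) ((g ∘ f) ∘ label) theta
    (label_map _) (theta_map _) (fun a => by simp [label_map])
    (fun a => by simp only [theta_map, WfRule.map_map, Function.comp_def]) t

theorem dup_map (f : X → Y) (t : Tree G e X) : dup (map f t) = map (map f) (dup t) :=
  hom_unique (φ := fun t => dup (map f t)) (ψ := fun t => map (map f) (dup t)) (map f) theta
    (fun a => label_dup _)
    (fun a => by simp only [theta_dup, theta_map, WfRule.map_map, Function.comp_def])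
    (fun a => by simp [label_map, label_dup])
    (fun a => by simp only [theta_dup, theta_map, WfRule.map_map, Function.comp_def]) t

theorem dup_dup (t : Tree G e X) : dup (dup t) = map dup (dup t) :=
  hom_unique (φ := fun t => dup (dup t)) (ψ := fun t => map dup (dup t)) dup theta
    (fun a => label_dup _)
    (fun a => by simp only [theta_dup, WfRule.map_map, Function.comp_def])
    (fun a => by simp [label_map, label_dup])
    (fun a => by simp only [theta_dup, theta_map, WfRule.map_map, Function.comp_def]) t

theorem map_label_dup (t : Tree G e X) : map label (dup t) = t :=
  hom_unique (φ := fun t => map label (dup t)) (ψ := fun t => t) label theta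
    (fun a => by simp [label_map, label_dup])
    (fun a => by simp only [theta_dup, theta_map, WfRule.map_map, Function.comp_def])
    (fun _ => rfl) (fun _ => (WfRule.map_id _).symm) t

end Tree

variable (G e) in
/-- The cofree comonad over `Lwfr`. -/
def cofreeComonad : Comonad (Type u) where
  obj X := Tree G e X
  map f := ↾(Tree.map f)
  map_id X := by ext t; exact Tree.map_id' t
  map_comp f g := by ext t; exact Tree.map_comp' f g t
  ε := { app X := ↾Tree.label, naturality X Y f := by ext t; exact Tree.label_ana _ _ t }
  δ := { app X := ↾Tree.dup, naturality X Y f := by ext t; exact Tree.dup_map f t }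
  coassoc X := by ext t; exact (Tree.dup_dup t).symm
  left_counit X := by ext t; exact Tree.label_ana _ _ t
  right_counit X := by ext t; exact Tree.map_label_dup t

variable (G e) in
/-- The natural transformation `χ` from the cofree comonad to `Lwfr`. -/
def chi : (cofreeComonad G e).toFunctor ⟶ Lwfr G e where
  app X := ↾Tree.chi
  naturality X Y f := by
    ext t
    change (Tree.map f t).theta.map Tree.label = (t.theta.map Tree.label).map f
    refine ((congrArg (WfRule.map Tree.label) (Tree.theta_map f t)).trans
      (WfRule.map_map _ _ _)).trans (Eq.trans ?_ (WfRule.map_map _ _ _).symm)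
    exact congrArg (fun g => WfRule.map g t.theta) (funext (Tree.label_map f))

/-- The extension `f♯ = ana ⟨id, f⟩` of an `Lwfr`-coalgebra to a coalgebra of the cofree
comonad. -/
def sharp {X : Type u} (f : X ⟶ (Lwfr G e).obj X) : X ⟶ (cofreeComonad G e).obj X :=
  ↾(Tree.ana id f)

/-! ## The shape-finitary subcomonad -/

namespace Tree

/-- The set of immediate subtrees. -/
def children (t : Tree G e X) : Set (Tree G e X) := t.theta.nonterminals

/-- The set of subtrees at depth `n`. -/
def subtreesAt (t : Tree G e X) : ℕ → Set (Tree G e X)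
  | 0 => {t}
  | n + 1 => ⋃ s ∈ subtreesAt t n, s.children

/-- The set of all rule shapes that occur in a tree, at any finite depth. -/
def shapes (t : Tree G e X) : Set (WfRule G e PUnit.{u + 1}) :=
  ⋃ n, (fun s => s.chi.shape) '' t.subtreesAt n

end Tree

/-- States that are reachable in exactly `n` steps in a coalgebra of well-formed rules. -/
def reach {A : Type u} (d : A → WfRule G e A) (a : A) : ℕ → Set A
  | 0 => {a}
  | n + 1 => ⋃ b ∈ reach d a n, (d b).nonterminals

/-- The shapes that occur in a tree are those reachable in any coalgebra that generates it. -/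
theorem shapes_eq {A : Type u} (d : A → WfRule G e A) (φ : A → Tree G e X)
    (h : ∀ a, (φ a).theta = (d a).map φ) (a : A) :
    (φ a).shapes = ⋃ n, (fun b => (d b).shape) '' reach d a n := by
  have key : ∀ n, (φ a).subtreesAt n = φ '' reach d a n := by
    intro n
    induction n with
    | zero => simp [Tree.subtreesAt, reach]
    | succ n ih =>
      simp only [Tree.subtreesAt, reach, ih, Set.biUnion_image, Set.image_iUnion, Tree.children,
        h, WfRule.nonterminals_map]
  unfold Tree.shapes
  refine Set.iUnion_congr fun n => ?_
  rw [key, Set.image_image]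
  refine Set.image_congr fun b _ => ?_
  simp only [Tree.chi, WfRule.shape_map, h]

variable (G e) in
/-- The trees in which only finitely many rule shapes occur. -/
abbrev FinTree (X : Type u) : Type u := {t : Tree G e X // t.shapes.Finite}

namespace FinTree

theorem finite_of_child (t : FinTree G e X) (s : Tree G e X) (hs : s ∈ t.1.theta.nonterminals) :
    s.shapes.Finite := by
  refine t.2.subset ?_
  have key : ∀ n, s.subtreesAt n ⊆ t.1.subtreesAt (n + 1) := by
    intro n
    induction n with
    | zero => simpa [Tree.subtreesAt, Tree.children] using hs
    | succ n ih => exact Set.biUnion_mono ih fun _ _ => le_rfl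
  exact Set.iUnion_subset fun n =>
    (Set.image_mono (key n)).trans
      (Set.subset_iUnion (fun n => (fun s => s.chi.shape) '' t.1.subtreesAt n) (n + 1))

/-- The root rule, over the immediate subtrees, which are shape-finitary again. -/
def theta (t : FinTree G e X) : WfRule G e (FinTree G e X) :=
  t.1.theta.restrict t.finite_of_child

theorem map_val_theta (t : FinTree G e X) : t.theta.map Subtype.val = t.1.theta :=
  WfRule.map_restrict _ _

/-- A tree that is generated along the structure of shape-finitary trees is shape-finitary. -/
theorem finite_of_hom (φ : FinTree G e X → Tree G e Y)
    (h : ∀ t, (φ t).theta = t.theta.map φ) (t : FinTree G e X) : (φ t).shapes.Finite := by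
  rw [shapes_eq theta φ h,
    ← shapes_eq theta (Subtype.val : FinTree G e X → Tree G e X)
      (fun t => t.map_val_theta.symm)]
  exact t.2

theorem theta_map_val (f : X → Y) (t : FinTree G e X) :
    (Tree.map f t.1).theta = t.theta.map fun s => Tree.map f s.1 := by
  rw [Tree.theta_map, ← map_val_theta, WfRule.map_map]
  rfl

/-- Relabelling. -/
def map (f : X → Y) (t : FinTree G e X) : FinTree G e Y :=
  ⟨Tree.map f t.1, finite_of_hom (fun s => Tree.map f s.1) (theta_map_val f) t⟩

/-- The comultiplication: every node is labelled with the subtree below it. -/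
def dup (t : FinTree G e X) : FinTree G e (FinTree G e X) :=
  ⟨Tree.ana id theta t, finite_of_hom _ (Tree.theta_ana _ _) t⟩

theorem theta_of_val (φ : FinTree G e X → FinTree G e Y)
    (h : ∀ t, (φ t).1.theta = t.theta.map fun s => (φ s).1) (t : FinTree G e X) :
    (φ t).theta = t.theta.map φ :=
  WfRule.map_injective Subtype.val_injective (by
    rw [map_val_theta, h, WfRule.map_map]
    rfl)

theorem theta_map (f : X → Y) (t : FinTree G e X) : (map f t).theta = t.theta.map (map f) :=
  theta_of_val _ (theta_map_val f) t

theorem theta_dup (t : FinTree G e X) : t.dup.theta = t.theta.map dup :=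
  theta_of_val _ (Tree.theta_ana _ _) t

theorem hom_unique {l : FinTree G e X → Y} {φ ψ : FinTree G e X → FinTree G e Y}
    (hφ : ∀ a, (φ a).1.label = l a) (hφ' : ∀ a, (φ a).theta = a.theta.map φ)
    (hψ : ∀ a, (ψ a).1.label = l a) (hψ' : ∀ a, (ψ a).theta = a.theta.map ψ)
    (a : FinTree G e X) : φ a = ψ a := by
  refine Subtype.ext (Tree.hom_unique l theta (φ := fun a => (φ a).1) (ψ := fun a => (ψ a).1)
    hφ (fun a => ?_) hψ (fun a => ?_) a)
  · rw [← map_val_theta, hφ', WfRule.map_map]; rfl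
  · rw [← map_val_theta, hψ', WfRule.map_map]; rfl

end FinTree

variable (G e) in
/-- The shape-finitary subcomonad of the cofree comonad over `Lwfr`. -/
def shapeFinitary : Comonad (Type u) where
  obj X := FinTree G e X
  map f := ↾(FinTree.map f)
  map_id X := by ext t : 3; exact Subtype.ext (Tree.map_id' t.1)
  map_comp f g := by ext t : 3; exact Subtype.ext (Tree.map_comp' f g t.1)
  ε :=
    { app X := ↾fun t => t.1.label
      naturality X Y f := by ext t; exact Tree.label_ana _ _ t.1 }
  δ :=
    { app X := ↾FinTree.dup
      naturality X Y f := by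
        ext t
        refine FinTree.hom_unique (l := FinTree.map f)
          (φ := fun t => FinTree.dup (FinTree.map f t))
          (ψ := fun t => FinTree.map (FinTree.map f) (FinTree.dup t)) ?_ ?_ ?_ ?_ t
        · exact fun a => Tree.label_ana _ _ _
        · intro a; rw [FinTree.theta_dup, FinTree.theta_map, WfRule.map_map]; rfl
        · exact fun a => (Tree.label_ana _ _ _).trans
            (congrArg (FinTree.map f) (Tree.label_ana _ _ a))
        · intro a; rw [FinTree.theta_map, FinTree.theta_dup, WfRule.map_map]; rfl }
  coassoc X := by
    ext t : 3
    refine FinTree.hom_unique (l := FinTree.dup)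
      (φ := fun t => FinTree.map FinTree.dup (FinTree.dup t))
      (ψ := fun t => FinTree.dup (FinTree.dup t)) ?_ ?_ ?_ ?_ t
    · exact fun a => (Tree.label_ana _ _ _).trans
        (congrArg FinTree.dup (Tree.label_ana _ _ a))
    · intro a; rw [FinTree.theta_map, FinTree.theta_dup, WfRule.map_map]; rfl
    · exact fun a => Tree.label_ana _ _ _
    · intro a; rw [FinTree.theta_dup, FinTree.theta_dup, WfRule.map_map]; rfl
  left_counit X := by ext t; exact Tree.label_ana _ _ t
  right_counit X := by
    ext t : 3
    refine FinTree.hom_unique (l := fun t => t.1.label)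
      (φ := fun t => FinTree.map (fun t => t.1.label) (FinTree.dup t))
      (ψ := fun t => t) ?_ ?_ ?_ ?_ t
    · exact fun a => (Tree.label_ana _ _ _).trans
        (congrArg (fun t : FinTree G e X => t.1.label) (Tree.label_ana _ _ a))
    · intro a; rw [FinTree.theta_map, FinTree.theta_dup, WfRule.map_map]; rfl
    · exact fun a => rfl
    · exact fun a => (WfRule.map_id _).symm

variable (G e) in
/-- The inclusion of the shape-finitary subcomonad, a morphism of comonads. -/
def incl : shapeFinitary G e ⟶ cofreeComonad G e where
  app X := ↾Subtype.val
  naturality X Y f := rfl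
  app_ε X := rfl
  app_δ X := by
    ext t
    refine Tree.hom_unique (l := Subtype.val) FinTree.theta
      (φ := fun t : FinTree G e X => Tree.dup t.1)
      (ψ := fun t => Tree.map Subtype.val (FinTree.dup t).1) ?_ ?_ ?_ ?_ t
    · exact fun a => Tree.label_ana _ _ _
    · intro a
      rw [Tree.theta_dup, ← FinTree.map_val_theta, WfRule.map_map]
      rfl
    · exact fun a => (Tree.label_ana _ _ _).trans (congrArg Subtype.val (Tree.label_ana _ _ a))
    · intro a
      rw [FinTree.theta_map_val, FinTree.theta_dup, WfRule.map_map]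
      rfl

/-! ## Rule interpretation and unit curves -/

/-- Composition of the subcurves in a list. The value matters only for arguments in
`[0, length]`. -/
noncomputable def step (e : V) : List (G ⊕ (unitInterval → V)) → ℝ → V
  | [], _ => 0
  | Sum.inl ρ :: u, x => if x ≤ 1 then 0 else (ρ : V ≃ₗᵢ[ℝ] V) (step e u (x - 1))
  | Sum.inr f :: u, x =>
    if h0 : x ≤ 0 then 0
    else if h1 : x < 1 then f ⟨x, (not_le.1 h0).le, h1.le⟩
    else if x = 1 then e
    else e + step e u (x - 1)

/-- Rule interpretation on arbitrary functions on the unit interval. -/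
noncomputable def draw (e : V) (r : FrRule G (unitInterval → V)) : unitInterval → V :=
  fun z => r.1⁻¹ • step e r.2.1 ((r.2.1.length : ℝ) * (z : ℝ))

variable (e) in
/-- The set `C₁` of unit curves: continuous curves on `[0, 1]` from `0` to `e`. -/
def UnitCurve : Type u := {f : C(unitInterval, V) // f 0 = 0 ∧ f 1 = e}

/-- The function underlying a unit curve. -/
def UnitCurve.toFun (f : UnitCurve e) : unitInterval → V := f.1

theorem step_zero (l : List (G ⊕ (unitInterval → V))) (x : ℝ) (hx : x ≤ 0) :
    step e l x = 0 := by
  cases l with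
  | nil => rfl
  | cons a t =>
    cases a with
    | inl ρ => simp [step, hx.trans zero_le_one]
    | inr f => simp [step, hx]

theorem continuous_step (l : List (G ⊕ UnitCurve e)) :
    Continuous (step e (l.map (Sum.map id UnitCurve.toFun))) := by
  induction l with
  | nil => exact continuous_const
  | cons a t ih =>
    have ih' := ih.comp (continuous_sub_right (1 : ℝ))
    cases a with
    | inl ρ =>
      refine Continuous.if_le (f' := fun _ : ℝ => (0 : V)) (f := fun x : ℝ => x) (g := fun _ => 1)
        continuous_const ((ρ : V ≃ₗᵢ[ℝ] V).continuous.comp ih') continuous_id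
        continuous_const ?_
      intro x hx
      simp [hx, step_zero]
    | inr f =>
      have h : Continuous fun x : ℝ => if x ≤ 1 then
          Set.IccExtend (zero_le_one' ℝ) f.toFun x
          else e + step e (t.map (Sum.map id UnitCurve.toFun)) (x - 1) := by
        refine Continuous.if_le (f := fun x : ℝ => x) (g := fun _ => 1)
          (f.1.continuous.Icc_extend' (h := zero_le_one' ℝ))
          (continuous_const.add ih') continuous_id continuous_const ?_
        intro x hx
        subst hx
        rw [Set.IccExtend_right]
        simp only [sub_self, step_zero _ _ le_rfl, add_zero]
        exact f.2.2
      convert h using 1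
      funext x
      simp only [List.map_cons, Sum.map_inr, step]
      split_ifs with h0 h1 h2 h1 h1 h2 h2
      · rw [Set.IccExtend_of_le_left _ _ h0]; exact f.2.1.symm
      · linarith
      · rw [Set.IccExtend_of_mem _ _ ⟨(not_le.1 h0).le, h2.le⟩]
      · linarith
      · subst h1; rw [Set.IccExtend_right]; exact f.2.2.symm
      · linarith
      · exact absurd (le_antisymm h2 (not_lt.1 ‹_›)) ‹_›
      · rfl

theorem step_length (l : List (G ⊕ (unitInterval → V))) :
    step e l (l.length : ℝ) = span e l := by
  induction l with
  | nil => rfl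
  | cons a t ih =>
    rcases t with _ | ⟨b, t⟩
    · cases a <;> simp [step, span]
    · have hpos : (0 : ℝ) < ((b :: t).length : ℝ) := by simp; positivity
      have h1 : ¬ (((b :: t).length : ℝ) + 1 ≤ 1) := by linarith
      have h0 : ¬ (((b :: t).length : ℝ) + 1 ≤ 0) := by linarith
      have h2 : ¬ (((b :: t).length : ℝ) + 1 < 1) := by linarith
      have h3 : ¬ (((b :: t).length : ℝ) + 1 = 1) := by linarith
      rw [List.length_cons, Nat.cast_add, Nat.cast_one]
      cases a with
      | inl ρ => rw [step, if_neg h1, add_sub_cancel_right, ih, span]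
      | inr f => rw [step, dif_neg h0, dif_neg h2, if_neg h3, add_sub_cancel_right, ih, span]

/-- The interpretation of a well-formed rule over unit curves, which is a unit curve again. -/
noncomputable def drawCurve (r : WfRule G e (UnitCurve e)) : UnitCurve e :=
  ⟨⟨draw e (r.1.map UnitCurve.toFun),
      ((continuous_step r.body).comp
        (continuous_const.mul continuous_subtype_val)).const_smul (r.1.1⁻¹)⟩, by
    have h : (r.1.1 : ℝ) ≠ 0 := (zero_lt_one.trans r.2.1).ne'
    constructor
    · change r.1.1⁻¹ • step e _ (_ * (0 : ℝ)) = 0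
      rw [mul_zero, step_zero _ _ le_rfl, smul_zero]
    · change r.1.1⁻¹ • step e (r.1.map UnitCurve.toFun).2.1
        (((r.1.map UnitCurve.toFun).2.1.length : ℝ) * (1 : ℝ)) = e
      rw [mul_one, step_length]
      change r.1.1⁻¹ • span e (r.body.map _) = e
      rw [span_map, r.2.2.1, smul_smul, inv_mul_cancel₀ h, one_smul]⟩

variable (G e) in
/-- The structure map of the `Lwfr`-algebra `(C₁, draw)`. -/
noncomputable def drawWfr : (Lwfr G e).obj (UnitCurve e) ⟶ UnitCurve e := ↾drawCurve

variable (G e) in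
/-- The coequation algebra `(C₁, k)` of the shape-finitary comonad, with `k` the restriction of
`draw ∘ χ` to shape-finitary trees. -/
noncomputable def coequation : Endofunctor.Algebra (shapeFinitary G e).toFunctor where
  a := UnitCurve e
  str := (incl G e).app (UnitCurve e) ≫ (chi G e).app (UnitCurve e) ≫ drawWfr G e

end

end FractalLSystem

namespace FractalLSystem

section

variable {V : Type u} [NormedAddCommGroup V] [NormedSpace ℝ V]
  {G : Subgroup (V ≃ₗᵢ[ℝ] V)} {e : V} {X : Type u}

/-! ## Composition of subcurves -/

/-! A coalgebra `g` of the comonad gives each state `x` a rule `d x`, the root rule of `g x` over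
the labels below it. By naturality of `χ`, a ca-homomorphism is the same as a solution of the system
`h x = drawCurve ((d x).map h)` (`isCAHom_coequation_iff`). Existence and uniqueness of solutions
rest on two different contractions.

Uniqueness contracts the parameter interval. Since `e ≠ 0` and the shrink factor exceeds 1, a rule
has at least two symbols, so drawing squeezes each subcurve into at most half of `[0, 1]`. If two
solutions agree at points within `δ` of every parameter, they then agree at points within `δ / 2`.
All unit curves agree at `0`, so two solutions agree on a dense set, hence everywhere by continuity
(`solution_unique`). No uniform bound on shrink factors enters.

Existence contracts the sup distance. Turns are isometries and translations cancel, so a rule with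
factor `a` contracts by `a⁻¹` (`dist_drawCurve_le`). Finitely many shapes below `x` give a common
ratio `q < 1` and a bound on the first step, so iteration from straight curves is Cauchy
(`exists_dist_approx_le`). The limits solve the system because each rule has finitely many
nonterminals (`exists_solution`). The comonad law `theta_of_dup_eq_map` identifies the shapes
occurring in `g x` with those reachable from `x` under `d`. -/

theorem step_inl_of_le (ρ : G) (l : List (G ⊕ (unitInterval → V))) {x : ℝ} (hx : x ≤ 1) :
    step e (Sum.inl ρ :: l) x = 0 := by
  simp [step, hx]

theorem step_inl_of_ge (ρ : G) (l : List (G ⊕ (unitInterval → V))) {x : ℝ} (hx : 1 ≤ x) :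
    step e (Sum.inl ρ :: l) x = (ρ : V ≃ₗᵢ[ℝ] V) (step e l (x - 1)) := by
  rcases hx.eq_or_lt with rfl | hx
  · simp [step, step_zero]
  · simp [step, hx.not_ge]

/-- The values `0` and `e` that `step` prescribes at the ends are those of a unit curve, so no
correction is needed there. -/
theorem step_inr_of_mem (c : UnitCurve e) (l : List (G ⊕ (unitInterval → V)))
    (x : unitInterval) : step e (Sum.inr c.toFun :: l) x = c.toFun x := by
  rw [step]
  split_ifs with h0 h1 h2
  · have : x = 0 := Subtype.ext (le_antisymm h0 x.2.1)
    rw [this]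
    exact c.2.1.symm
  · rfl
  · have : x = 1 := Subtype.ext h2
    rw [this]
    exact c.2.2.symm
  · exact absurd (le_antisymm x.2.2 (not_lt.1 h1)) h2

theorem step_inr_of_ge (c : unitInterval → V) (l : List (G ⊕ (unitInterval → V))) {x : ℝ}
    (hx : 1 ≤ x) : step e (Sum.inr c :: l) x = e + step e l (x - 1) := by
  rw [step, dif_neg (by linarith), dif_neg (by linarith)]
  split_ifs with h
  · rw [h, sub_self, step_zero _ _ le_rfl, add_zero]
  · rfl

/-- The list of symbols with the curves assigned to its nonterminals. -/
abbrev plug (h : X → UnitCurve e) (l : List (G ⊕ X)) : List (G ⊕ (unitInterval → V)) :=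
  l.map (Sum.map id fun x => (h x).toFun)

/-- At a given `x` only one symbol is being traced; the turns before it are isometries and the
translations are common to both sides. Hence the bound does not grow with the length of the list. -/
theorem norm_step_sub_step_le {h h' : X → UnitCurve e} {M : ℝ} (hM : 0 ≤ M)
    (l : List (G ⊕ X))
    (H : ∀ b, Sum.inr b ∈ l → ∀ z, ‖(h b).toFun z - (h' b).toFun z‖ ≤ M) (x : ℝ) :
    ‖step e (plug h l) x - step e (plug h' l) x‖ ≤ M := by
  induction l generalizing x with
  | nil => simpa [step] using hM
  | cons s l ih =>
    have ih' := ih (fun b hb => H b (List.mem_cons_of_mem _ hb)) (x - 1)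
    rcases le_total x 1 with hx | hx
    · rcases s with ρ | b
      · simpa [step_inl_of_le ρ _ hx] using hM
      · rcases le_total x 0 with h0 | h0
        · simpa [step_zero _ _ h0] using hM
        · have := H b List.mem_cons_self ⟨x, h0, hx⟩
          rwa [← step_inr_of_mem (h b) (plug h l), ← step_inr_of_mem (h' b) (plug h' l)] at this
    · rcases s with ρ | b
      · simp only [List.map_cons, Sum.map_inl, id, step_inl_of_ge ρ _ hx]
        rwa [← map_sub, LinearIsometryEquiv.norm_map]
      · simp only [List.map_cons, Sum.map_inr, step_inr_of_ge _ _ hx]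
        rwa [add_sub_add_left_eq_sub]

/-- The point is sought in the unit interval of the symbol traced at `x`: a nonterminal supplies it
through `H`, and on a turn both curves rest, so `x` itself serves. -/
theorem exists_step_eq_step_near {h h' : X → UnitCurve e} {δ : ℝ} (hδ : 0 ≤ δ)
    (H : ∀ b, ∀ z : unitInterval, ∃ w : unitInterval,
      |(z : ℝ) - w| ≤ δ ∧ (h b).toFun w = (h' b).toFun w)
    (l : List (G ⊕ X)) {x : ℝ} (hx : x ∈ Set.Icc (0 : ℝ) l.length) :
    ∃ y ∈ Set.Icc (0 : ℝ) l.length, |x - y| ≤ δ ∧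
      step e (plug h l) y = step e (plug h' l) y := by
  induction l generalizing x with
  | nil => exact ⟨x, hx, by simpa using hδ, rfl⟩
  | cons s l ih =>
    have hl : ((s :: l).length : ℝ) = l.length + 1 := by simp
    have hl0 : (0 : ℝ) ≤ l.length := Nat.cast_nonneg _
    rw [hl] at hx ⊢
    rcases le_total x 1 with hx1 | hx1
    · rcases s with ρ | b
      · exact ⟨x, hx, by simpa using hδ, by
          simp only [List.map_cons, Sum.map_inl, id, step_inl_of_le ρ _ hx1]⟩
      · obtain ⟨w, hw, hw'⟩ := H b ⟨x, hx.1, hx1⟩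
        refine ⟨w, ⟨w.2.1, by linarith [w.2.2]⟩, hw, ?_⟩
        simp only [List.map_cons, Sum.map_inr, step_inr_of_mem, hw']
    · obtain ⟨y, hy, hxy, hs⟩ := ih (x := x - 1) ⟨by linarith, by linarith [hx.2]⟩
      refine ⟨y + 1, ⟨by linarith [hy.1], by linarith [hy.2]⟩, by
        rwa [show x - (y + 1) = x - 1 - y by ring], ?_⟩
      have hy1 : 1 ≤ y + 1 := by linarith [hy.1]
      rcases s with ρ | b
      · simp only [List.map_cons, Sum.map_inl, id, step_inl_of_ge ρ _ hy1, add_sub_cancel_right,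
          hs]
      · simp only [List.map_cons, Sum.map_inr, step_inr_of_ge _ _ hy1, add_sub_cancel_right, hs]

/-! ## Rule interpretation -/

theorem norm_span_le (l : List (G ⊕ X)) : ‖span e l‖ ≤ l.length * ‖e‖ := by
  induction l with
  | nil => simp [span]
  | cons s l ih =>
    rw [List.length_cons, Nat.cast_add, Nat.cast_one, add_mul, one_mul]
    rcases s with ρ | b
    · rw [span, LinearIsometryEquiv.norm_map]
      linarith [norm_nonneg e]
    · rw [span]
      linarith [norm_add_le e (span e l)]

/-- Each symbol moves by at most `‖e‖`, so the length is at least the shrink factor, which exceeds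
1; integrality then gives 2. -/
theorem WfRule.two_le_length (he : e ≠ 0) (r : WfRule G e X) : (2 : ℝ) ≤ r.body.length := by
  have h := norm_span_le (e := e) r.body
  have ha := r.2.1
  rw [r.2.2.1, norm_smul, Real.norm_of_nonneg (by linarith)] at h
  have : (1 : ℝ) < r.body.length := ha.trans_le (le_of_mul_le_mul_right h (norm_pos_iff.2 he))
  exact_mod_cast this

theorem drawCurve_map_toFun (r : WfRule G e X) (h : X → UnitCurve e) (z : unitInterval) :
    (drawCurve (r.map h)).toFun z = r.1.1⁻¹ • step e (plug h r.body) (r.body.length * z) := by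
  change r.1.1⁻¹ • step e ((r.body.map (Sum.map id h)).map (Sum.map id UnitCurve.toFun))
    ((((r.body.map (Sum.map id h)).map (Sum.map id UnitCurve.toFun)).length : ℝ) * z) = _
  rw [List.map_map, List.length_map]
  simp only [Sum.map_comp_map]
  rfl

/-- The hypothesis concerns only nonterminals that occur in the rule, so that the estimate can be
iterated along reachable states. -/
theorem dist_drawCurve_le (r : WfRule G e X) {h h' : X → UnitCurve e} {M : ℝ} (hM : 0 ≤ M)
    (H : ∀ b ∈ r.nonterminals, dist (h b).1 (h' b).1 ≤ M) :
    dist (drawCurve (r.map h)).1 (drawCurve (r.map h')).1 ≤ r.1.1⁻¹ * M := by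
  have ha : 0 ≤ r.1.1⁻¹ := inv_nonneg.2 (zero_le_one.trans r.2.1.le)
  refine (ContinuousMap.dist_le (mul_nonneg ha hM)).2 fun z => ?_
  change dist ((drawCurve (r.map h)).toFun z) ((drawCurve (r.map h')).toFun z) ≤ _
  rw [drawCurve_map_toFun, drawCurve_map_toFun, dist_eq_norm, ← smul_sub, norm_smul,
    Real.norm_of_nonneg ha]
  refine mul_le_mul_of_nonneg_left (norm_step_sub_step_le hM _ (fun b hb w => ?_) _) ha
  rw [← dist_eq_norm]
  exact (ContinuousMap.dist_apply_le_dist w).trans (H b hb)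

/-- Rescaling `[0, length]` to `[0, 1]` divides distances between parameters by the length, which is
at least 2. -/
theorem exists_drawCurve_eq_near (he : e ≠ 0) {h h' : X → UnitCurve e} {δ : ℝ} (hδ : 0 ≤ δ)
    (H : ∀ b, ∀ z : unitInterval, ∃ w : unitInterval,
      |(z : ℝ) - w| ≤ δ ∧ (h b).toFun w = (h' b).toFun w)
    (r : WfRule G e X) (z : unitInterval) :
    ∃ w : unitInterval, |(z : ℝ) - w| ≤ δ / 2 ∧
      (drawCurve (r.map h)).toFun w = (drawCurve (r.map h')).toFun w := by
  have hl := r.two_le_length he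
  have hl0 : (0 : ℝ) < r.body.length := by linarith
  obtain ⟨y, hy, hzy, hs⟩ := exists_step_eq_step_near hδ H r.body
    (x := r.body.length * z) ⟨mul_nonneg hl0.le z.2.1, mul_le_of_le_one_right hl0.le z.2.2⟩
  refine ⟨⟨y / r.body.length, div_nonneg hy.1 hl0.le, (div_le_one hl0).2 hy.2⟩, ?_, ?_⟩
  · have : (z : ℝ) - y / r.body.length = (r.body.length * z - y) / r.body.length := by
      field_simp
    rw [this, abs_div, abs_of_pos hl0]
    exact div_le_div₀ hδ hzy two_pos hl
  · rw [drawCurve_map_toFun, drawCurve_map_toFun, mul_div_cancel₀ _ hl0.ne', hs]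

/-! ## Uniqueness and existence of solutions -/

theorem solution_unique (he : e ≠ 0) (d : X → WfRule G e X) {h h' : X → UnitCurve e}
    (H : ∀ x, h x = drawCurve ((d x).map h)) (H' : ∀ x, h' x = drawCurve ((d x).map h')) :
    h = h' := by
  have key : ∀ (n : ℕ) (x : X) (z : unitInterval), ∃ w : unitInterval,
      |(z : ℝ) - w| ≤ (1 / 2) ^ n ∧ (h x).toFun w = (h' x).toFun w := by
    intro n
    induction n with
    | zero =>
      intro x z
      -- All unit curves start at `0`, and the parameter `0` is within `1 = (1 / 2) ^ 0` of every
      -- `z`.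
      refine ⟨0, ?_, (h x).2.1.trans (h' x).2.1.symm⟩
      simpa [abs_of_nonneg z.2.1] using z.2.2
    | succ n ih =>
      intro x z
      obtain ⟨w, hw, hw'⟩ := exists_drawCurve_eq_near he (by positivity) ih (d x) z
      rw [← H, ← H'] at hw'
      exact ⟨w, hw.trans_eq (by ring), hw'⟩
  funext x
  refine Subtype.ext (ContinuousMap.ext fun z => ?_)
  have hc : IsClosed {w | (h x).1 w = (h' x).1 w} :=
    isClosed_eq (h x).1.continuous (h' x).1.continuous
  choose w hw hw' using fun n => key n x z
  refine show z ∈ {w | (h x).1 w = (h' x).1 w} from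
    hc.mem_of_tendsto (f := w) (b := Filter.atTop) ?_ (.of_forall hw')
  rw [tendsto_iff_dist_tendsto_zero]
  refine squeeze_zero (fun _ => dist_nonneg) (fun n => ?_)
    (tendsto_pow_atTop_nhds_zero_of_lt_one (by norm_num) (by norm_num : (1 / 2 : ℝ) < 1))
  rw [dist_comm, Subtype.dist_eq, Real.dist_eq]
  exact hw n

variable (e) in
/-- The straight unit curve. -/
def UnitCurve.line : UnitCurve e :=
  ⟨⟨fun z => (z : ℝ) • e, continuous_subtype_val.smul continuous_const⟩, by simp⟩

/-- Approximations of the curves described by a coalgebra of rules, starting from straight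
curves. -/
noncomputable def approx (d : X → WfRule G e X) : ℕ → X → UnitCurve e
  | 0, _ => UnitCurve.line e
  | n + 1, x => drawCurve ((d x).map (approx d n))

/-- `K` is the largest first step and `q` the largest inverse shrink factor among the finitely many
reachable shapes. -/
theorem exists_dist_approx_le (d : X → WfRule G e X) (x : X)
    (hd : (⋃ n, (fun b => (d b).shape) '' reach d x n).Finite) :
    ∃ K q : ℝ, q < 1 ∧ ∀ n, dist (approx d n x).1 (approx d (n + 1) x).1 ≤ K * q ^ n := by
  let S := ⋃ n, (fun b => (d b).shape) '' reach d x n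
  have hS : ∀ {m b}, b ∈ reach d x m → (d b).shape ∈ S := fun hb =>
    Set.mem_iUnion.2 ⟨_, _, hb, rfl⟩
  -- All states start from the same straight curve, so the first approximation depends only on the
  -- shape of the rule.
  let first : WfRule G e PUnit.{u + 1} → UnitCurve e := fun s =>
    drawCurve (s.map fun _ => UnitCurve.line e)
  have hne : S.Nonempty := ⟨_, hS (m := 0) (Set.mem_singleton x)⟩
  obtain ⟨s, -, hs⟩ := Set.exists_max_image S
    (fun s => dist (UnitCurve.line e).1 (first s).1) hd hne
  obtain ⟨s', -, hs'⟩ := Set.exists_max_image S (fun s => s.1.1⁻¹) hd hne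
  have hq0 : 0 ≤ s'.1.1⁻¹ := inv_nonneg.2 (zero_le_one.trans s'.2.1.le)
  refine ⟨dist (UnitCurve.line e).1 (first s).1, s'.1.1⁻¹, inv_lt_one_of_one_lt₀ s'.2.1, ?_⟩
  -- The induction passes from a state to the nonterminals of its rule, so the bound is needed at
  -- all reachable states, with the same constants.
  suffices H : ∀ n m, ∀ b ∈ reach d x m, dist (approx d n b).1 (approx d (n + 1) b).1 ≤
      dist (UnitCurve.line e).1 (first s).1 * s'.1.1⁻¹ ^ n from
    fun n => H n 0 x (Set.mem_singleton x)
  intro n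
  induction n with
  | zero =>
    intro m b hb
    rw [pow_zero, mul_one]
    refine (le_of_eq ?_).trans (hs _ (hS hb))
    change _ = dist _ (drawCurve ((d b).shape.map _)).1
    rw [WfRule.shape, WfRule.map_map]
    rfl
  | succ n ih =>
    intro m b hb
    have hM : 0 ≤ dist (UnitCurve.line e).1 (first s).1 * s'.1.1⁻¹ ^ n := by positivity
    refine (dist_drawCurve_le (d b) hM fun c hc =>
      ih (m + 1) c (Set.mem_iUnion₂.2 ⟨b, hb, hc⟩)).trans ?_
    refine (mul_le_mul_of_nonneg_right (hs' _ (hS hb)) hM).trans_eq ?_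
    ring

/-- Completeness of `V` gives a continuous uniform limit; its end values are inherited pointwise. -/
theorem exists_tendsto_approx [CompleteSpace V] (d : X → WfRule G e X) (x : X)
    (hd : (⋃ n, (fun b => (d b).shape) '' reach d x n).Finite) :
    ∃ c : UnitCurve e, Filter.Tendsto (fun n => (approx d n x).1) Filter.atTop (nhds c.1) := by
  obtain ⟨K, q, hq, H⟩ := exists_dist_approx_le d x hd
  obtain ⟨c, hc⟩ := cauchySeq_tendsto_of_complete (cauchySeq_of_le_geometric q K hq H)
  have hz : ∀ z v, (∀ n, (approx d n x).1 z = v) → c z = v := fun z v hv =>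
    tendsto_nhds_unique (((continuous_eval_const z).tendsto c).comp hc)
      (tendsto_const_nhds.congr fun n => (hv n).symm)
  exact ⟨⟨c, hz 0 0 fun n => (approx d n x).2.1, hz 1 e fun n => (approx d n x).2.2⟩, hc⟩

theorem WfRule.finite_nonterminals (r : WfRule G e X) : r.nonterminals.Finite :=
  (List.finite_toSet r.body).preimage Sum.inr_injective.injOn

/-- The rate of convergence may vary with the state, but only the finitely many nonterminals of `d
x` matter for the equation at `x`. -/
theorem exists_solution [CompleteSpace V] (d : X → WfRule G e X)
    (hd : ∀ x, (⋃ n, (fun b => (d b).shape) '' reach d x n).Finite) :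
    ∃ h : X → UnitCurve e, ∀ x, h x = drawCurve ((d x).map h) := by
  choose h hh using fun x => exists_tendsto_approx d x (hd x)
  -- The approximations with index `n + 1` tend both to `h x` and to the curve drawn from the
  -- limits.
  refine ⟨h, fun x => Subtype.ext (tendsto_nhds_unique
    ((hh x).comp (Filter.tendsto_add_atTop_nat 1)) (Metric.tendsto_atTop'.2 fun ε hε => ?_))⟩
  have hev : ∀ᶠ n in Filter.atTop, ∀ b ∈ (d x).nonterminals,
      dist (approx d n b).1 (h b).1 ≤ ε / 2 :=
    (Filter.eventually_all_finite (d x).finite_nonterminals).2 fun b _ =>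
      ((hh b).eventually (Metric.closedBall_mem_nhds _ (half_pos hε)))
  obtain ⟨N, hN⟩ := Filter.eventually_atTop.1 hev
  refine ⟨N, fun n hn => (dist_drawCurve_le (d x) (half_pos hε).le (hN n hn.le)).trans_lt ?_⟩
  have := mul_le_of_le_one_left (half_pos hε).le (inv_lt_one_of_one_lt₀ (d x).2.1).le
  linarith

/-! ## Coalgebras of the shape-finitary comonad -/

theorem isCAHom_coequation_iff (g : X ⟶ (shapeFinitary G e).obj X) (h : X ⟶ UnitCurve e) :
    IsCAHom (shapeFinitary G e).toFunctor g (coequation G e).str h ↔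
      ∀ x, h x = drawCurve ((Tree.chi (X := X) (g x : FinTree G e X).1).map h) := by
  have key : ∀ x, (g ≫ (shapeFinitary G e).map h ≫ (coequation G e).str) x =
      drawCurve ((Tree.chi (X := X) (g x : FinTree G e X).1).map h) := by
    intro x
    change drawCurve (Tree.chi (Tree.map h (g x : FinTree G e X).1)) = _
    rw [Tree.chi, Tree.theta_map, WfRule.map_map, Tree.chi, WfRule.map_map]
    congr 2
  refine ⟨fun H x => (congrArg (fun k : X ⟶ UnitCurve e => k x) H).trans (key x), fun H => ?_⟩
  ext x : 3
  exact (H x).trans (key x).symm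

/-- Coassociativity forces the subtrees of `a x` to be the trees `a y` of their labels `y`. The
proof compares root rules and reads off, at each child, the underlying tree of its label. -/
theorem theta_of_dup_eq_map {a : X → FinTree G e X} (H : ∀ x, (a x).dup = (a x).map a) (x : X) :
    (a x).1.theta = (a x).1.chi.map fun y => (a y).1 := by
  have h := congrArg (fun t => (FinTree.theta t).map fun s => s.1.label.1) (H x)
  simp only [FinTree.theta_dup, FinTree.theta_map, WfRule.map_map] at h
  have h1 : ((fun s : FinTree G e (FinTree G e X) => s.1.label.1) ∘ FinTree.dup) =
      Subtype.val := funext fun t => congrArg Subtype.val (Tree.label_ana _ _ t)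
  have h2 : ((fun s : FinTree G e (FinTree G e X) => s.1.label.1) ∘ FinTree.map a) =
      (fun y => (a y).1) ∘ Tree.label ∘ Subtype.val :=
    funext fun t => congrArg Subtype.val (Tree.label_map _ t.1)
  rw [h1, h2, FinTree.map_val_theta] at h
  rw [h, Tree.chi, ← FinTree.map_val_theta, WfRule.map_map, WfRule.map_map]
  rfl

theorem isCorecursive_coequation [CompleteSpace V] (he : e ≠ 0) :
    IsCorecursive (shapeFinitary G e) (coequation G e) := by
  intro A
  let d : A.A → WfRule G e A.A := fun x => Tree.chi (A.a x : FinTree G e A.A).1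
  have hd : ∀ x, (⋃ n, (fun b => (d b).shape) '' reach d x n).Finite := fun x => by
    rw [← shapes_eq d (fun y => (A.a y : FinTree G e A.A).1) (theta_of_dup_eq_map (a := A.a)
      fun x => congrArg (fun k : A.A ⟶ _ => k x) A.coassoc)]
    exact (A.a x : FinTree G e A.A).2
  obtain ⟨h, hh⟩ := exists_solution d hd
  refine ⟨↾h, (isCAHom_coequation_iff A.a (↾h)).2 hh, fun h' H' => ?_⟩
  ext x : 3
  exact congrFun (solution_unique he d ((isCAHom_coequation_iff A.a h').1 H') hh) x

/-! ## Finite systems of rules -/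

theorem chi_sharp (f : X → WfRule G e X) (x : X) : (Tree.ana id f x).chi = f x := by
  rw [Tree.chi, Tree.theta_ana, WfRule.map_map]
  exact (congrArg (fun k => (f x).map k) (funext (Tree.label_ana id f))).trans (WfRule.map_id _)

/-- The trees generated by a finite system of rules are shape-finitary. -/
def finSharp [Finite X] (f : X → WfRule G e X) (x : X) : FinTree G e X :=
  ⟨Tree.ana id f x, by
    rw [shapes_eq f _ (Tree.theta_ana id f)]
    exact (Set.finite_range fun b => (f b).shape).subset
      (Set.iUnion_subset fun _ => Set.image_subset_range _ _)⟩

/-- Both sides are coalgebra morphisms from `⟨finSharp f, f⟩`, so finality identifies them. -/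
theorem dup_finSharp [Finite X] (f : X → WfRule G e X) (x : X) :
    (finSharp f x).dup = (finSharp f x).map (finSharp f) := by
  have hθ : ∀ x, (finSharp f x).theta = (f x).map (finSharp f) := fun x =>
    WfRule.map_injective Subtype.val_injective (by
      rw [FinTree.map_val_theta, WfRule.map_map]
      exact Tree.theta_ana id f x)
  refine Subtype.ext (Tree.hom_unique (finSharp f) f (φ := fun x => (finSharp f x).dup.1)
    (ψ := fun x => ((finSharp f x).map (finSharp f)).1)
    (fun a => Tree.label_ana _ _ _) (fun a => ?_)
    (fun a => (Tree.label_map _ _).trans (congrArg _ (Tree.label_ana id f a))) (fun a => ?_) x)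
  · rw [← FinTree.map_val_theta, FinTree.theta_dup, hθ, WfRule.map_map, WfRule.map_map]
    rfl
  · rw [← FinTree.map_val_theta, FinTree.theta_map, hθ, WfRule.map_map, WfRule.map_map]
    rfl

end

end FractalLSystem

/-! ### Corecursiveness and the case of finite systems -/

theorem mainTheorem9 {V : Type u} [NormedAddCommGroup V] [NormedSpace ℝ V] [CompleteSpace V]
    (G : Subgroup (V ≃ₗᵢ[ℝ] V)) (e : V) (he : e ≠ 0) :
    FractalLSystem.IsCorecursive (FractalLSystem.shapeFinitary G e)
        (FractalLSystem.coequation G e) ∧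
      ∀ (X : Type u) [Finite X] (f : X ⟶ (FractalLSystem.Lwfr G e).obj X),
        ∃ g : X ⟶ (FractalLSystem.shapeFinitary G e).obj X,
          g ≫ (FractalLSystem.incl G e).app X = FractalLSystem.sharp f ∧
          g ≫ (FractalLSystem.shapeFinitary G e).ε.app X = 𝟙 X ∧
          g ≫ (FractalLSystem.shapeFinitary G e).δ.app X =
            g ≫ (FractalLSystem.shapeFinitary G e).map g ∧
          (∃! h : X ⟶ FractalLSystem.UnitCurve e,
            FractalLSystem.IsCAHom (FractalLSystem.shapeFinitary G e).toFunctor g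
              (FractalLSystem.coequation G e).str h) ∧
          ∀ h : X ⟶ FractalLSystem.UnitCurve e,
            FractalLSystem.IsCAHom (FractalLSystem.shapeFinitary G e).toFunctor g
                (FractalLSystem.coequation G e).str h ↔
              FractalLSystem.IsCAHom (FractalLSystem.Lwfr G e) f
                (FractalLSystem.drawWfr G e) h := by
  refine ⟨FractalLSystem.isCorecursive_coequation he, fun X _ f => ?_⟩
  let g : X ⟶ (FractalLSystem.shapeFinitary G e).obj X := ↾(FractalLSystem.finSharp f)
  have hε : g ≫ (FractalLSystem.shapeFinitary G e).ε.app X = 𝟙 X := by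
    ext x
    exact FractalLSystem.Tree.label_ana id f x
  have hδ : g ≫ (FractalLSystem.shapeFinitary G e).δ.app X =
      g ≫ (FractalLSystem.shapeFinitary G e).map g := by
    ext x : 3
    exact FractalLSystem.dup_finSharp f x
  refine ⟨g, rfl, hε, hδ, FractalLSystem.isCorecursive_coequation he ⟨X, g, hε, hδ⟩,
    fun h => (FractalLSystem.isCAHom_coequation_iff g h).trans ?_⟩
  -- The root rule of the generated tree over its labels is `f x` again, so both kinds of
  -- ca-homomorphism satisfy the same pointwise equation.
  have hχ : ∀ x, FractalLSystem.Tree.chi (X := X)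
      (g x : FractalLSystem.FinTree G e X).1 = f x := FractalLSystem.chi_sharp f
  simp only [hχ]
  refine ⟨fun H => ?_, fun H x => congrArg (fun k : X ⟶ FractalLSystem.UnitCurve e => k x) H⟩
  ext x : 3
  exact H x
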